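/- A word $x\in\{0,1\}^*$ is \emph{totally balanced} if it contains as many $1$'s as $0$'s and every prefix of $x$ contains at least as many $1$'s as $0$'s. The \emph{nesting level} $\ell(x)$ of a totally balanced word is defined recursively by $\ell(\epsilon)=0$ and $\ell(1y0z)=\max(\ell(y)+1,\ell(z))$ for totally balanced $y,z$. The base-$2$ representation of a natural number is written most significant digit first without leading zeros, and that of $0$ is the empty word $\epsilon$. Let $S_{\rm TB}$ be the set of natural numbers whose base-$2$ representation is totally balanced, and let $L_6$ be the set of totally balanced words $x$ with $\ell(x)\le 3$. Summands need not be distinct. (1) An even natural number is the sum of at most $3$ elements of $S_{\rm TB}$ if and only if it is not one of $8, 18, 28, 38, 40, 82, 166$. (2) There are infinitely many even natural numbers that are not the sum of at most $2$ elements of $S_{\rm TB}$. (3) An even natural number is the sum of at most $3$ natural numbers whose base-$2$ representation lies in $L_6$ if and only if it is not one of $8, 18, 28, 38, 40, 82, 166$. -/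

import Mathlib

/-- A word over `{0,1}` (with `true` standing for `1` and `false` for `0`) is totally balanced if it
has as many `1`s as `0`s and no prefix of it has more `0`s than `1`s. -/
def TotallyBalanced (x : List Bool) : Prop :=
  x.count true = x.count false ∧ ∀ p : List Bool, p <+: x → p.count false ≤ p.count true

/-- `HasNestingLevel x m` says that the recursively defined nesting level `ℓ(x)` is `m`:
`ℓ(ε) = 0`, and `ℓ(1y0z) = max (ℓ(y) + 1) (ℓ(z))` for totally balanced `y` and `z`.
By `TotallyBalanced.existsUnique_nestingLevel` below this defines `ℓ` on all totally balanced
words. -/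
inductive HasNestingLevel : List Bool → ℕ → Prop
  | nil : HasNestingLevel [] 0
  | node {y z : List Bool} {a b : ℕ} (hy : TotallyBalanced y) (hz : TotallyBalanced z)
      (ha : HasNestingLevel y a) (hb : HasNestingLevel z b) :
      HasNestingLevel (true :: (y ++ false :: z)) (max (a + 1) b)

theorem TotallyBalanced.decomp_unique {y z y' z' : List Bool} (hy : TotallyBalanced y)
    (hy' : TotallyBalanced y') (h : y ++ false :: z = y' ++ false :: z') : y = y' ∧ z = z' := by
  rcases List.append_eq_append_iff.1 h with ⟨c, rfl, hc⟩ | ⟨c, rfl, hc⟩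
  · cases c with
    | nil => simp at hc; simp [hc]
    | cons d c =>
      simp only [List.cons_append, List.cons.injEq] at hc
      obtain ⟨rfl, -⟩ := hc
      have h1 := hy'.2 (y ++ [false]) ⟨c, by simp⟩
      have h2 := hy.1
      simp at h1
      omega
  · cases c with
    | nil => simp at hc; simp [hc]
    | cons d c =>
      simp only [List.cons_append, List.cons.injEq] at hc
      obtain ⟨rfl, -⟩ := hc
      have h1 := hy.2 (y' ++ [false]) ⟨c, by simp⟩
      have h2 := hy'.1
      simp at h1
      omega

theorem TotallyBalanced.exists_decomp {x : List Bool} (hx : TotallyBalanced x) (hne : x ≠ []) :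
    ∃ y z, TotallyBalanced y ∧ TotallyBalanced z ∧ x = true :: (y ++ false :: z) := by
  obtain ⟨d, w, rfl⟩ := List.exists_cons_of_ne_nil hne
  have hd : d = true := by
    have := hx.2 [d] ⟨w, rfl⟩
    cases d <;> simp_all
  subst hd
  have hex : ∃ i, (w.take i).count true < (w.take i).count false :=
    ⟨w.length, by have := hx.1; simp at this ⊢; omega⟩
  classical
  obtain ⟨i, hi, hmin⟩ : ∃ i, (w.take i).count true < (w.take i).count false ∧
      ∀ j < i, (w.take j).count false ≤ (w.take j).count true :=
    ⟨Nat.find hex, Nat.find_spec hex, fun j hj => not_lt.1 (Nat.find_min hex hj)⟩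
  cases i with
  | zero => simp at hi
  | succ k =>
    have hk : k < w.length := by
      by_contra hk
      have h1 := hmin k (by omega)
      rw [List.take_of_length_le (by omega)] at h1 hi
      omega
    have hk1 := hmin k (by omega)
    have htk : w.take (k + 1) = w.take k ++ [w[k]] := by simp
    have hwk : w[k] = false := by
      by_contra hc
      simp only [Bool.not_eq_false] at hc
      rw [htk, hc] at hi
      simp at hi
      omega
    rw [htk, hwk] at hi
    simp at hi
    have hw : w = w.take k ++ false :: w.drop (k + 1) := by
      rw [← hwk, List.getElem_cons_drop, List.take_append_drop]
    have hy : TotallyBalanced (w.take k) := by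
      refine ⟨by omega, fun p hp => ?_⟩
      have hpl := hp.length_le
      rw [List.length_take] at hpl
      have hpw : p = w.take p.length := (List.prefix_iff_eq_take.1 (hp.trans (List.take_prefix _ _)))
      rw [hpw]
      exact hmin _ (by omega)
    refine ⟨w.take k, w.drop (k + 1), hy, ?_, by rw [← hw]⟩
    have hy1 := hy.1
    generalize w.take k = y at *
    generalize w.drop (k + 1) = z at *
    clear hmin hwk htk hk
    subst hw
    refine ⟨by have := hx.1; simp at this; omega, fun p hp => ?_⟩
    obtain ⟨t, rfl⟩ := hp
    have := hx.2 (true :: (y ++ false :: p)) ⟨t, by simp⟩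
    simp at this
    omega

theorem TotallyBalanced.existsUnique_nestingLevel {x : List Bool} (hx : TotallyBalanced x) :
    ∃! m, HasNestingLevel x m := by
  induction hn : x.length using Nat.strong_induction_on generalizing x with
  | _ n ih =>
    subst hn
    by_cases hne : x = []
    · subst hne
      exact ⟨0, .nil, fun m hm => by cases hm; rfl⟩
    · obtain ⟨y, z, hy, hz, rfl⟩ := hx.exists_decomp hne
      obtain ⟨a, ha, hau⟩ := ih y.length (by simp) hy rfl
      obtain ⟨b, hb, hbu⟩ := ih z.length (by simp; omega) hz rfl
      refine ⟨_, .node hy hz ha hb, fun m hm => ?_⟩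
      generalize hw : true :: (y ++ false :: z) = w at hm
      cases hm with
      | nil => simp at hw
      | node hy' hz' ha' hb' =>
        obtain ⟨rfl, rfl⟩ := hy.decomp_unique hy' (by simpa using hw)
        rw [hau _ ha', hbu _ hb']

/-- The canonical base-2 representation of `n`, most significant digit first, without leading
zeros; the representation of `0` is the empty word. -/
def binaryWord (n : ℕ) : List Bool := n.bits.reverse

/-- The set of natural numbers whose base-2 representation is totally balanced. -/
def totallyBalancedNumbers : Set ℕ := {n | TotallyBalanced (binaryWord n)}

/-- The language of totally balanced words of nesting level at most `3`. -/
def balancedLevelThree : Language Bool :=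
  {x | TotallyBalanced x ∧ ∃ m ≤ 3, HasNestingLevel x m}

/-- `n` is the sum of at most `k` (not necessarily distinct) elements of `S`. -/
def IsSumOfAtMost (k : ℕ) (S : Set ℕ) (n : ℕ) : Prop :=
  ∃ l : List ℕ, l.length ≤ k ∧ (∀ s ∈ l, s ∈ S) ∧ l.sum = n

section Words

theorem totallyBalanced_iff_inits (x : List Bool) :
    TotallyBalanced x ↔
      x.count true = x.count false ∧ ∀ p ∈ x.inits, p.count false ≤ p.count true := by
  simp [TotallyBalanced]

instance : DecidablePred TotallyBalanced := fun x =>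
  decidable_of_iff _ (totallyBalanced_iff_inits x).symm

theorem TotallyBalanced.even_length {x : List Bool} (hx : TotallyBalanced x) :
    Even x.length := by
  have h : x.count true + x.count false = x.length := List.count_true_add_count_false x
  exact ⟨x.count true, by rw [← h, hx.1]⟩

/-- A totally balanced word whose prefixes have excess at most `k` has nesting level at most `k`. -/
theorem TotallyBalanced.exists_nestingLevel_le {k : ℕ} {x : List Bool} (hx : TotallyBalanced x)
    (hk : ∀ p, p <+: x → p.count true ≤ p.count false + k) :
    ∃ m ≤ k, HasNestingLevel x m := by
  induction hn : x.length using Nat.strong_induction_on generalizing x k with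
  | _ n ih =>
    subst hn
    by_cases hne : x = []
    · subst hne
      exact ⟨0, Nat.zero_le k, .nil⟩
    · obtain ⟨y, z, hy, hz, rfl⟩ := hx.exists_decomp hne
      have hk1 : 1 ≤ k := by simpa using hk [true] ⟨y ++ false :: z, rfl⟩
      obtain ⟨a, hak, ha⟩ := ih y.length (by simp) (k := k - 1) hy (fun p hp => by
        obtain ⟨t, rfl⟩ := hp
        have := hk (true :: p) ⟨t ++ false :: z, by simp⟩
        simp at this
        omega) rfl
      obtain ⟨b, hbk, hb⟩ := ih z.length (by simp; omega) (k := k) hz (fun p hp => by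
        obtain ⟨t, rfl⟩ := hp
        have := hk (true :: (y ++ false :: p)) ⟨t, by simp⟩
        have := hy.1
        simp at *
        omega) rfl
      exact ⟨max (a + 1) b, by omega, .node hy hz ha hb⟩

/-- `LevelRun h l` says that reading `l`, with `0` as an up step and `1` as a down step, leads from
height `h` to height `0` without leaving the heights `0, …, 3`. -/
def LevelRun : ℕ → List Bool → Prop
  | h, [] => h = 0
  | h, false :: l => h < 3 ∧ LevelRun (h + 1) l
  | h, true :: l => 0 < h ∧ LevelRun (h - 1) l

instance LevelRun.instDecidable : ∀ (h : ℕ) (l : List Bool), Decidable (LevelRun h l)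
  | h, [] => inferInstanceAs (Decidable (h = 0))
  | h, false :: l => @instDecidableAnd _ _ _ (LevelRun.instDecidable (h + 1) l)
  | h, true :: l => @instDecidableAnd _ _ _ (LevelRun.instDecidable (h - 1) l)

theorem LevelRun.count_eq {h : ℕ} {l : List Bool} (hl : LevelRun h l) :
    l.count true = l.count false + h := by
  induction l generalizing h with
  | nil => simpa [LevelRun] using hl.symm
  | cons d l ih =>
    cases d
    · have := ih hl.2
      simp
      omega
    · have := ih hl.2
      have := hl.1
      simp
      omega

theorem LevelRun.exists_of_suffix {h : ℕ} {l t : List Bool} (hl : LevelRun h l) (hh : h ≤ 3)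
    (ht : t <:+ l) : ∃ h' ≤ 3, LevelRun h' t := by
  induction l generalizing h with
  | nil => exact ⟨h, hh, by rwa [List.suffix_nil.1 ht]⟩
  | cons d l ih =>
    rcases List.suffix_cons_iff.1 ht with rfl | ht'
    · exact ⟨h, hh, hl⟩
    · cases d
      · exact ih hl.2 hl.1 ht'
      · exact ih hl.2 (by omega) ht'

theorem LevelRun.reverse_mem_balancedLevelThree {l : List Bool} (hl : LevelRun 0 l) :
    l.reverse ∈ balancedLevelThree := by
  have hp : ∀ p, p <+: l.reverse → ∃ h ≤ 3, p.count true = p.count false + h := fun p hp => by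
    obtain ⟨h, hh, hr⟩ := hl.exists_of_suffix (t := p.reverse) (by omega)
      (by rwa [← List.reverse_prefix, List.reverse_reverse])
    exact ⟨h, hh, by simpa using hr.count_eq⟩
  have hb : TotallyBalanced l.reverse :=
    ⟨by simpa using hl.count_eq, fun p h => by obtain ⟨_, _, h⟩ := hp p h; omega⟩
  exact ⟨hb, hb.exists_nestingLevel_le fun p h => by obtain ⟨_, _, h⟩ := hp p h; omega⟩

end Words

section Automaton

/-- The binary digits of `s`, least significant first, can complete a summand that is in state `q`:
a state `q < 4` is a height, and `4` marks a summand all of whose digits have been read. -/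
def Completes (q s : ℕ) : Prop :=
  (q = 4 ∧ s = 0) ∨ (q ≤ 3 ∧ LevelRun q s.bits)

/-- The states that a summand in state `q` may move to when its next digit is `d`. -/
def nextStates : ℕ → Bool → List ℕ
  | 0, false => [1, 4]
  | 1, false => [2]
  | 2, false => [3]
  | 4, false => [4]
  | 1, true => [0]
  | 2, true => [1]
  | 3, true => [2]
  | _, _ => []

theorem LevelRun.bits_double {h s : ℕ} (hh : h < 3) (hs : LevelRun (h + 1) s.bits) :
    LevelRun h (2 * s).bits := by
  have hs0 : s ≠ 0 := by
    rintro rfl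
    simp [LevelRun] at hs
  rw [Nat.bit0_bits _ hs0]
  exact ⟨hh, hs⟩

theorem LevelRun.bits_double_add_one {h s : ℕ} (hs : LevelRun h s.bits) :
    LevelRun (h + 1) (2 * s + 1).bits := by
  rw [Nat.bit1_bits]
  exact ⟨by omega, hs⟩

theorem Completes.of_mem_nextStates {q q' s : ℕ} {d : Bool} (hq : q' ∈ nextStates q d)
    (hs : Completes q' s) : Completes q (2 * s + d.toNat) := by
  have up {h s : ℕ} (hh : h < 3) (hs : Completes (h + 1) s) : Completes h (2 * s) :=
    .inr ⟨hh.le, (hs.resolve_left (by omega)).2.bits_double hh⟩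
  have down {h s : ℕ} (hh : h < 3) (hs : Completes h s) : Completes (h + 1) (2 * s + 1) :=
    .inr ⟨hh, (hs.resolve_left (by omega)).2.bits_double_add_one⟩
  have done {s : ℕ} (hs : Completes 4 s) : s = 0 := (hs.resolve_right (by omega)).2
  unfold nextStates at hq
  split at hq <;> simp only [List.mem_cons, List.not_mem_nil, or_false] at hq
  · rcases hq with rfl | rfl
    · exact up (by omega) hs
    · obtain rfl := done hs
      exact .inr ⟨by omega, by simp [LevelRun]⟩
  · subst hq
    exact up (by omega) hs
  · subst hq
    exact up (by omega) hs
  · exact .inl ⟨rfl, by simp [done (hq ▸ hs)]⟩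
  · exact down (by omega) (hq ▸ hs)
  · exact down (by omega) (hq ▸ hs)
  · exact down (by omega) (hq ▸ hs)

/-- The states of three summands together with a carry. -/
structure SumState where
  fst : ℕ
  snd : ℕ
  trd : ℕ
  carry : ℕ
deriving DecidableEq

/-- Three summands in state `t` can be completed so that the remaining digits and the carry add up
to `n`. -/
def SumState.Represents (t : SumState) (n : ℕ) : Prop :=
  ∃ x y z, Completes t.fst x ∧ Completes t.snd y ∧ Completes t.trd z ∧ x + y + z + t.carry = n

/-- The states reachable from `t` when the next digit of the sum is `b`. -/
def SumState.successors (t : SumState) (b : Bool) : List SumState :=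
  [false, true].flatMap fun d => [false, true].flatMap fun e => [false, true].flatMap fun f =>
    let c := d.toNat + e.toNat + f.toNat + t.carry
    if c % 2 = b.toNat then
      (nextStates t.fst d).flatMap fun x => (nextStates t.snd e).flatMap fun y =>
        (nextStates t.trd f).map fun z => ⟨x, y, z, c / 2⟩
    else []

theorem SumState.Represents.of_mem_successors {t t' : SumState} {b : Bool} {n : ℕ}
    (ht : t' ∈ t.successors b) (hn : t'.Represents n) : t.Represents (2 * n + b.toNat) := by
  simp only [successors, List.mem_flatMap] at ht
  obtain ⟨d, -, e, -, f, -, ht⟩ := ht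
  split_ifs at ht with hc
  · simp only [List.mem_flatMap, List.mem_map] at ht
    obtain ⟨p, hp, q, hq, r, hr, rfl⟩ := ht
    obtain ⟨x, y, z, hx, hy, hz, rfl⟩ := hn
    exact ⟨_, _, _, hx.of_mem_nextStates hp, hy.of_mem_nextStates hq, hz.of_mem_nextStates hr,
      by dsimp only; omega⟩
  · simp at ht

/-- Some state in `S` represents `n`. -/
def SetRepresents (S : List SumState) (n : ℕ) : Prop :=
  ∃ t ∈ S, t.Represents n

/-- The states that suffice to represent all large even numbers. -/
def usefulStates : List SumState :=
  [⟨0, 0, 0, 1⟩, ⟨0, 0, 0, 2⟩, ⟨0, 0, 4, 1⟩, ⟨0, 2, 0, 1⟩, ⟨0, 2, 0, 2⟩, ⟨1, 1, 1, 0⟩,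
    ⟨1, 1, 1, 1⟩, ⟨1, 1, 1, 2⟩, ⟨1, 1, 4, 0⟩, ⟨1, 1, 4, 1⟩, ⟨1, 3, 1, 1⟩, ⟨1, 3, 3, 1⟩,
    ⟨2, 2, 0, 0⟩, ⟨2, 2, 0, 1⟩, ⟨2, 2, 2, 0⟩, ⟨2, 2, 2, 1⟩, ⟨3, 1, 1, 0⟩, ⟨3, 3, 1, 0⟩,
    ⟨3, 3, 3, 0⟩, ⟨4, 0, 0, 1⟩, ⟨4, 0, 4, 0⟩, ⟨4, 0, 4, 1⟩, ⟨4, 1, 1, 0⟩, ⟨4, 1, 4, 0⟩,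
    ⟨4, 1, 4, 1⟩, ⟨4, 2, 0, 0⟩, ⟨4, 2, 4, 0⟩, ⟨4, 4, 4, 0⟩, ⟨4, 4, 4, 1⟩]

/-- The useful states reachable from `S` when the next digit of the sum is `b`. -/
def stepSet (S : List SumState) (b : Bool) : List SumState :=
  usefulStates.filter fun t' => S.any fun t => t' ∈ t.successors b

theorem SetRepresents.of_subset_stepSet {S T : List SumState} {b : Bool} {n : ℕ}
    (hT : T ⊆ stepSet S b) (hn : SetRepresents T n) : SetRepresents S (2 * n + b.toNat) := by
  obtain ⟨t', ht', hn⟩ := hn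
  have h := (List.mem_filter.1 (hT ht')).2
  simp only [List.any_eq_true, decide_eq_true_eq] at h
  obtain ⟨t, ht, h⟩ := h
  exact ⟨t, ht, hn.of_mem_successors h⟩

/-- Sets of states from which every positive number is represented. -/
def universalSets : List (List SumState) :=
  [[⟨0, 0, 0, 2⟩, ⟨0, 2, 0, 2⟩, ⟨2, 2, 0, 1⟩, ⟨2, 2, 2, 1⟩, ⟨4, 0, 4, 1⟩],
    [⟨1, 1, 1, 1⟩, ⟨1, 1, 1, 2⟩, ⟨1, 1, 4, 1⟩, ⟨1, 3, 1, 1⟩, ⟨1, 3, 3, 1⟩, ⟨4, 1, 4, 1⟩,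
      ⟨4, 4, 4, 1⟩],
    [⟨1, 1, 1, 1⟩, ⟨1, 1, 4, 0⟩, ⟨1, 1, 4, 1⟩, ⟨3, 3, 1, 0⟩, ⟨4, 1, 4, 0⟩, ⟨4, 4, 4, 0⟩],
    [⟨0, 0, 0, 2⟩, ⟨0, 0, 4, 1⟩, ⟨2, 2, 0, 1⟩, ⟨2, 2, 2, 1⟩, ⟨4, 2, 4, 0⟩, ⟨4, 4, 4, 0⟩],
    [⟨0, 0, 4, 1⟩, ⟨0, 2, 0, 1⟩, ⟨2, 2, 0, 1⟩, ⟨2, 2, 2, 0⟩, ⟨4, 0, 4, 0⟩],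
    [⟨1, 1, 1, 1⟩, ⟨1, 1, 4, 1⟩, ⟨1, 3, 1, 1⟩, ⟨3, 3, 3, 0⟩, ⟨4, 1, 4, 0⟩, ⟨4, 1, 4, 1⟩,
      ⟨4, 4, 4, 0⟩]]

theorem universalSets_closed :
    ∀ S ∈ universalSets, ∀ b, ∃ T ∈ universalSets, T ⊆ stepSet S b := by
  decide +kernel

theorem SumState.represents_carry {t : SumState} (h₁ : t.fst = 0 ∨ t.fst = 4)
    (h₂ : t.snd = 0 ∨ t.snd = 4) (h₃ : t.trd = 0 ∨ t.trd = 4) : t.Represents t.carry := by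
  have key {q : ℕ} (hq : q = 0 ∨ q = 4) : Completes q 0 := by
    rcases hq with rfl | rfl
    · exact .inr ⟨by omega, by simp [LevelRun]⟩
    · exact .inl ⟨rfl, rfl⟩
  exact ⟨0, 0, 0, key h₁, key h₂, key h₃, by simp⟩

theorem universalSets_accept :
    ∀ S ∈ universalSets, ∃ t ∈ stepSet S true, (t.fst = 0 ∨ t.fst = 4) ∧
      (t.snd = 0 ∨ t.snd = 4) ∧ (t.trd = 0 ∨ t.trd = 4) ∧ t.carry = 0 := by
  decide +kernel

theorem setRepresents_of_mem_universalSets {S : List SumState} (hS : S ∈ universalSets) {n : ℕ}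
    (hn : 1 ≤ n) : SetRepresents S n := by
  induction n using Nat.strong_induction_on generalizing S with
  | _ n ih =>
    obtain ⟨b, m, rfl⟩ : ∃ (b : Bool) (m : ℕ), n = 2 * m + b.toNat :=
      ⟨n.bodd, n.div2, by have := Nat.bodd_add_div2 n; omega⟩
    rcases Nat.eq_zero_or_pos m with rfl | hm
    · have hb : b = true := by cases b <;> simp_all
      subst hb
      obtain ⟨t, ht, h₁, h₂, h₃, h₄⟩ := universalSets_accept S hS
      exact .of_subset_stepSet (T := [t]) (by simpa using ht)
        ⟨t, by simp, h₄ ▸ SumState.represents_carry h₁ h₂ h₃⟩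
    · obtain ⟨T, hT, hTS⟩ := universalSets_closed S hS b
      exact .of_subset_stepSet hTS (ih m (by omega) hT hm)

/-- After reading at most `k` more digits from `S`, a superset of a universal set is reached. -/
def reachesUniversal : ℕ → List SumState → Bool
  | 0, S => universalSets.any fun T => T ⊆ S
  | k + 1, S => (universalSets.any fun T => T ⊆ S) ||
      (reachesUniversal k (stepSet S false) && reachesUniversal k (stepSet S true))

theorem setRepresents_of_reachesUniversal {k : ℕ} {S : List SumState}
    (hS : reachesUniversal k S = true) {n : ℕ} (hn : 2 ^ k ≤ n) : SetRepresents S n := by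
  have base {S : List SumState} {n : ℕ} (hS : (universalSets.any fun T => T ⊆ S) = true)
      (hn : 1 ≤ n) : SetRepresents S n := by
    simp only [List.any_eq_true, decide_eq_true_eq] at hS
    obtain ⟨T, hT, hTS⟩ := hS
    obtain ⟨t, ht, h⟩ := setRepresents_of_mem_universalSets hT hn
    exact ⟨t, hTS ht, h⟩
  induction k generalizing S n with
  | zero => exact base hS (by simpa using hn)
  | succ k ih =>
    rw [reachesUniversal, Bool.or_eq_true, Bool.and_eq_true] at hS
    rcases hS with hS | ⟨h₀, h₁⟩
    · exact base hS (Nat.one_le_two_pow.trans hn)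
    · obtain ⟨b, m, rfl⟩ : ∃ (b : Bool) (m : ℕ), n = 2 * m + b.toNat :=
        ⟨n.bodd, n.div2, by have := Nat.bodd_add_div2 n; omega⟩
      have hm : 2 ^ k ≤ m := by
        have := b.toNat_le
        rw [pow_succ] at hn
        omega
      exact .of_subset_stepSet (List.Subset.refl _) (by cases b <;> [exact ih h₀ hm; exact ih h₁ hm])

theorem reachesUniversal_initial : reachesUniversal 8 (stepSet [⟨0, 0, 0, 0⟩] false) = true := by
  decide +kernel

theorem exists_three_of_large {n : ℕ} (hn : 512 ≤ n) (he : Even n) :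
    ∃ x y z, LevelRun 0 x.bits ∧ LevelRun 0 y.bits ∧ LevelRun 0 z.bits ∧ x + y + z = n := by
  obtain ⟨m, rfl⟩ := he.two_dvd
  have h : SetRepresents [⟨0, 0, 0, 0⟩] (2 * m + false.toNat) :=
    .of_subset_stepSet (List.Subset.refl _)
      (setRepresents_of_reachesUniversal reachesUniversal_initial (by omega))
  obtain ⟨t, ht, x, y, z, hx, hy, hz, h⟩ := h
  obtain rfl := List.mem_singleton.1 ht
  exact ⟨x, y, z, (hx.resolve_left (by simp)).2, (hy.resolve_left (by simp)).2,
    (hz.resolve_left (by simp)).2, by simpa using h⟩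

end Automaton

section SmallNumbers

/-- The numbers below `512` whose binary words are totally balanced of nesting level at most `3`. -/
def smallLevelThree : List ℕ :=
  [0, 2, 10, 12, 42, 44, 50, 52, 56, 170, 172, 178, 180, 184,
    202, 204, 210, 212, 216, 226, 228, 232]

theorem levelRun_bits_of_mem_smallLevelThree {s : ℕ} (hs : s ∈ smallLevelThree) :
    LevelRun 0 s.bits := by
  revert s
  decide +kernel

/-- The number whose binary digits mark the elements of `smallLevelThree`. -/
def levelThreeMask : ℕ := (smallLevelThree.map (2 ^ ·)).sum

theorem levelRun_bits_of_testBit :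
    ∀ s < 512, levelThreeMask.testBit s = true → LevelRun 0 s.bits := by
  decide +kernel

theorem exists_three_of_small : ∀ m < 256, 2 * m ∉ [8, 18, 28, 38, 40, 82, 166] →
    ∃ x ∈ smallLevelThree, ∃ y ∈ smallLevelThree, x + y ≤ 2 * m ∧
      levelThreeMask.testBit (2 * m - (x + y)) = true := by
  decide +kernel

theorem mem_of_totallyBalanced_of_le : ∀ s < 167, TotallyBalanced (binaryWord s) →
    s ∈ [0, 2, 10, 12, 42, 44, 50, 52, 56] := by
  decide +kernel

end SmallNumbers

theorem isSumOfAtMost_three_iff {S : Set ℕ} (h0 : 0 ∈ S) {n : ℕ} :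
    IsSumOfAtMost 3 S n ↔ ∃ x ∈ S, ∃ y ∈ S, ∃ z ∈ S, x + y + z = n := by
  constructor
  · rintro ⟨l, hl, hS, rfl⟩
    match l, hl, hS with
    | [], _, _ => exact ⟨0, h0, 0, h0, 0, h0, rfl⟩
    | [x], _, hS => exact ⟨x, hS x (by simp), 0, h0, 0, h0, by simp⟩
    | [x, y], _, hS => exact ⟨x, hS x (by simp), y, hS y (by simp), 0, h0, by simp⟩
    | [x, y, z], _, hS =>
      exact ⟨x, hS x (by simp), y, hS y (by simp), z, hS z (by simp), by simp [add_assoc]⟩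
  · rintro ⟨x, hx, y, hy, z, hz, rfl⟩
    exact ⟨[x, y, z], by simp, by simp [hx, hy, hz], by simp [add_assoc]⟩

theorem IsSumOfAtMost.mono {k n : ℕ} {S T : Set ℕ} (h : S ⊆ T) (hn : IsSumOfAtMost k S n) :
    IsSumOfAtMost k T n := by
  obtain ⟨l, hl, hS, hn⟩ := hn
  exact ⟨l, hl, fun s hs => h (hS s hs), hn⟩

theorem setOf_balancedLevelThree_subset :
    {s : ℕ | binaryWord s ∈ balancedLevelThree} ⊆ totallyBalancedNumbers := fun _ hs => hs.1

theorem isSumOfAtMost_three_balancedLevelThree {n : ℕ} (he : Even n)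
    (hn : n ∉ ({8, 18, 28, 38, 40, 82, 166} : Set ℕ)) :
    IsSumOfAtMost 3 {s : ℕ | binaryWord s ∈ balancedLevelThree} n := by
  suffices h : ∃ x y z, LevelRun 0 x.bits ∧ LevelRun 0 y.bits ∧ LevelRun 0 z.bits ∧
      x + y + z = n by
    obtain ⟨x, y, z, hx, hy, hz, rfl⟩ := h
    exact ⟨[x, y, z], by simp, by
      simpa [binaryWord] using ⟨hx.reverse_mem_balancedLevelThree,
        hy.reverse_mem_balancedLevelThree, hz.reverse_mem_balancedLevelThree⟩, by simp [add_assoc]⟩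
  rcases le_or_gt 512 n with h | h
  · exact exists_three_of_large h he
  · obtain ⟨m, rfl⟩ := he.two_dvd
    obtain ⟨x, hx, y, hy, hle, hz⟩ := exists_three_of_small m (by omega) (by simpa using hn)
    exact ⟨x, y, _, levelRun_bits_of_mem_smallLevelThree hx,
      levelRun_bits_of_mem_smallLevelThree hy, levelRun_bits_of_testBit _ (by omega) hz, by omega⟩

theorem not_isSumOfAtMost_three_of_exceptional {n : ℕ}
    (hn : n ∈ ({8, 18, 28, 38, 40, 82, 166} : Set ℕ)) :
    ¬ IsSumOfAtMost 3 totallyBalancedNumbers n := by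
  rw [isSumOfAtMost_three_iff (by simp [totallyBalancedNumbers, binaryWord, TotallyBalanced])]
  rintro ⟨x, hx, y, hy, z, hz, h⟩
  have hle : n < 167 := by
    simp only [Set.mem_insert_iff, Set.mem_singleton_iff] at hn
    omega
  have key : ∀ x ∈ [0, 2, 10, 12, 42, 44, 50, 52, 56], ∀ y ∈ [0, 2, 10, 12, 42, 44, 50, 52, 56],
      ∀ z ∈ [0, 2, 10, 12, 42, 44, 50, 52, 56],
        x + y + z ∉ [8, 18, 28, 38, 40, 82, 166] := by
    decide +kernel
  exact key x (mem_of_totallyBalanced_of_le x (by omega) hx)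
    y (mem_of_totallyBalanced_of_le y (by omega) hy)
    z (mem_of_totallyBalanced_of_le z (by omega) hz) (by simpa [h] using hn)

theorem binaryWord_two_pow (k : ℕ) :
    binaryWord (2 ^ k) = true :: List.replicate k false := by
  induction k with
  | zero => simp [binaryWord]
  | succ k ih =>
    rw [binaryWord, pow_succ', Nat.bit0_bits _ (by positivity), List.reverse_cons,
      List.replicate_succ', ← List.cons_append, ← ih, binaryWord]

theorem two_pow_notMem_totallyBalancedNumbers {k : ℕ} (hk : 2 ≤ k) :
    2 ^ k ∉ totallyBalancedNumbers := fun h => by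
  have := h.1
  rw [binaryWord_two_pow] at this
  simp [List.count_replicate] at this
  omega

theorem even_size_of_mem_totallyBalancedNumbers {s : ℕ} (hs : s ∈ totallyBalancedNumbers) :
    Even s.size := by
  have := TotallyBalanced.even_length hs
  rwa [binaryWord, List.length_reverse, Nat.size_eq_bits_len] at this

theorem lt_of_mem_totallyBalancedNumbers {m s : ℕ} (hm : 1 ≤ m)
    (hs : s ∈ totallyBalancedNumbers) (hle : s ≤ 2 ^ (2 * m + 1)) : s < 2 ^ (2 * m) := by
  have hne : s ≠ 2 ^ (2 * m + 1) := fun h =>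
    two_pow_notMem_totallyBalancedNumbers (by omega) (h ▸ hs)
  have h₁ : s.size ≤ 2 * m + 1 := Nat.size_le.2 (by omega)
  obtain ⟨r, hr⟩ := even_size_of_mem_totallyBalancedNumbers hs
  exact Nat.size_le.1 (by omega)

theorem not_isSumOfAtMost_two_two_pow {m : ℕ} (hm : 1 ≤ m) :
    ¬ IsSumOfAtMost 2 totallyBalancedNumbers (2 ^ (2 * m + 1)) := by
  rintro ⟨l, hl, hS, h⟩
  have hlt : ∀ s ∈ l, s ≤ 2 ^ (2 * m) - 1 := fun s hs =>
    Nat.le_sub_one_of_lt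
      (lt_of_mem_totallyBalancedNumbers hm (hS s hs) (h ▸ List.single_le_sum (by simp) s hs))
  have hsum := List.sum_le_card_nsmul l _ hlt
  have hpos : 0 < 2 ^ (2 * m) := by positivity
  have := Nat.mul_le_mul_right (2 ^ (2 * m) - 1) hl
  rw [h, smul_eq_mul, pow_succ] at hsum
  omega

theorem infinite_not_isSumOfAtMost_two :
    {n : ℕ | Even n ∧ ¬ IsSumOfAtMost 2 totallyBalancedNumbers n}.Infinite := by
  refine Set.infinite_of_injective_forall_mem (f := fun m : ℕ => 2 ^ (2 * (m + 1) + 1))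
    (fun a b h => ?_) fun m => ⟨?_, not_isSumOfAtMost_two_two_pow (by omega)⟩
  · have := Nat.pow_right_injective le_rfl h
    omega
  · exact (even_two).pow_of_ne_zero (by omega)

theorem mainTheorem7 :
    (∀ n : ℕ, Even n →
      (IsSumOfAtMost 3 totallyBalancedNumbers n ↔
        n ∉ ({8, 18, 28, 38, 40, 82, 166} : Set ℕ))) ∧
    {n : ℕ | Even n ∧ ¬ IsSumOfAtMost 2 totallyBalancedNumbers n}.Infinite ∧
    (∀ n : ℕ, Even n →
      (IsSumOfAtMost 3 {s : ℕ | binaryWord s ∈ balancedLevelThree} n ↔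
        n ∉ ({8, 18, 28, 38, 40, 82, 166} : Set ℕ))) := by
  refine ⟨fun n he => ⟨fun h hn => not_isSumOfAtMost_three_of_exceptional hn h, fun hn => ?_⟩,
    infinite_not_isSumOfAtMost_two, fun n he => ⟨fun h hn => ?_, fun hn => ?_⟩⟩
  · exact (isSumOfAtMost_three_balancedLevelThree he hn).mono setOf_balancedLevelThree_subset
  · exact not_isSumOfAtMost_three_of_exceptional hn (h.mono setOf_balancedLevelThree_subset)
  · exact isSumOfAtMost_three_balancedLevelThree he hn
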